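/- A (deterministic, bi-infinite) bidding sequence is a nondecreasing sequence $x=(x_i)_{i\in\mathbb Z}$ of positive reals such that for every $u>0$ there is an $i$ with $x_{i-1}<u\le x_i$; its cost on a threshold $u>0$ is $\operatorname{cost}(x,u)=\sum_{j\le i}x_j\in[0,\infty]$ for this $i$. A randomized bidding sequence is a sequence $X=(X_i)_{i\in\mathbb Z}$ of real random variables on a probability space that is almost surely a bidding sequence; its normalized cost on $u>0$ is $\operatorname{nc}(X,u)=\mathbb E[\operatorname{cost}(X,u)]/u\in[0,\infty]$. Its robustness is $\operatorname{rob}(X)=\sup_{u>0}\operatorname{nc}(X,u)$, and $X$ is $R$-robust if $\operatorname{rob}(X)\le R$. Its consistency is $\operatorname{cons}(X)=\inf_{u>0}\operatorname{nc}(X,u)$, and its consistency for a prediction $\hat u>0$ is $\operatorname{nc}(X,\hat u)$. **Theorem.** Let $R>e$ and let $\overline w>1$ be the largest solution $w>0$ of $w e^{1/w}=R$. Then for every $\varepsilon>0$, every $R$-robust randomized bidding sequence $X$ satisfies $$\operatorname{cons}(X)\ \ge\ R-\overline w-\varepsilon ,$$ and in particular $\operatorname{nc}(X,\hat u)\ge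 R-\overline w-\varepsilon$ for every prediction $\hat u>0$. -/

import Mathlib

open MeasureTheory
open scoped ENNReal

/-- A (deterministic, bi-infinite) bidding sequence: a nondecreasing sequence of positive bids such
that, for every threshold `u > 0`, there is a first bid that reaches `u`. Given positivity and
monotonicity, the last condition says that the bids tend to `0` at `-∞` and are unbounded. -/
structure IsBiddingSequence (x : ℤ → ℝ) : Prop where
  pos : ∀ i, 0 < x i
  mono : Monotone x
  reaches : ∀ u : ℝ, 0 < u → ∃ i : ℤ, x (i - 1) < u ∧ u ≤ x i

/-- A randomized bidding sequence on a measure space: a sequence of real random variables which is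
almost surely a bidding sequence. -/
structure IsRandomizedBiddingSequence {Ω : Type*} [MeasurableSpace Ω] (μ : Measure Ω)
    (X : ℤ → Ω → ℝ) : Prop where
  measurable : ∀ i, Measurable (X i)
  ae_bidding : ∀ᵐ ω ∂μ, IsBiddingSequence (fun i => X i ω)

open Classical in
/-- The cost of the bids `x` on the threshold `u`: the sum (in `[0, ∞]`) of all bids submitted up
to and including the first bid that reaches `u`. The bid `x j` is submitted exactly when the
preceding bid `x (j - 1)` is below `u`; see `bidCost_eq` for the form `∑_{j ≤ i} x j`, where
`x (i - 1) < u ≤ x i`. -/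
noncomputable def bidCost (x : ℤ → ℝ) (u : ℝ) : ℝ≥0∞ :=
  ∑' j : ℤ, if x (j - 1) < u then ENNReal.ofReal (x j) else 0

theorem bidCost_eq {x : ℤ → ℝ} (hx : Monotone x) {u : ℝ} {i : ℤ} (h₁ : x (i - 1) < u)
    (h₂ : u ≤ x i) : bidCost x u = ∑' j : Set.Iic i, ENNReal.ofReal (x j) := by
  classical
  rw [tsum_subtype (Set.Iic i) (fun j => ENNReal.ofReal (x j)), bidCost]
  refine tsum_congr fun j => ?_
  by_cases hj : j ≤ i
  · have : x (j - 1) < u := lt_of_le_of_lt (hx (by omega)) h₁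
    simp [hj, this]
  · have : ¬ x (j - 1) < u := not_lt.2 (h₂.trans (hx (by omega)))
    simp [hj, this]

/-- The normalized cost of a randomized bidding sequence on the threshold `u`: its expected cost
divided by `u`. -/
noncomputable def normalizedCost {Ω : Type*} [MeasurableSpace Ω] (μ : Measure Ω)
    (X : ℤ → Ω → ℝ) (u : ℝ) : ℝ≥0∞ :=
  (∫⁻ ω, bidCost (fun i => X i ω) u ∂μ) / ENNReal.ofReal u

/-- Robustness: the supremum of the normalized cost over all thresholds `u > 0`. -/
noncomputable def robustness {Ω : Type*} [MeasurableSpace Ω] (μ : Measure Ω)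
    (X : ℤ → Ω → ℝ) : ℝ≥0∞ :=
  ⨆ (u : ℝ) (_ : 0 < u), normalizedCost μ X u

/-- Consistency for the prediction `û`: the normalized cost on the threshold `û`. -/
noncomputable def consistencyAt {Ω : Type*} [MeasurableSpace Ω] (μ : Measure Ω)
    (X : ℤ → Ω → ℝ) (û : ℝ) : ℝ≥0∞ :=
  normalizedCost μ X û

/-- Consistency in its scale-invariant form: the infimum of the normalized cost over all
thresholds `u > 0`. -/
noncomputable def consistency {Ω : Type*} [MeasurableSpace Ω] (μ : Measure Ω)
    (X : ℤ → Ω → ℝ) : ℝ≥0∞ :=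
  ⨅ (u : ℝ) (_ : 0 < u), normalizedCost μ X u

/-! Fix the threshold `U`. Let `a v` be the expected sum of the bids below `U`, each truncated at
`v`, and `M u` the expected number of bids in `[u, U)`; `M` bounds the slope of `a`. Charging `v` to
the bid that first reaches `u` turns robustness into `a v + v ≤ R * u + v * M u`. For the conjugate
`Q t = sup (a v + v * t)` this reads `Q (1 - M u) ≤ R * u`. As `u` acts as a maximizer at `t = -M
u`, it becomes `Q (t + 1) ≤ R * Q' t` for `t < 0`. Nonnegative solutions of this advanced inequality
are constrained at `0` (`boundary_le_of_advanced_growth`). With `Q t ≥ a U + U * t` this bounds `a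
U` below (`le_profile_of_robust`), and the cost at `U` is at least `a U + U` in expectation. -/

/-! ### The advanced differential inequality. -/

open Filter Topology in
/-- A nonnegative function which grows at least as fast as the advanced equation
`R * Q' t = Q (t + 1)` demands on `(-∞, 0)` satisfies the boundary inequality obtained by pairing
this equation with `exp (-k * t)`, where `k` is the smaller characteristic exponent. -/
theorem boundary_le_of_advanced_growth {Q : ℝ → ℝ} {R k : ℝ} (hR : 0 < R) (hk₀ : 0 < k)
    (hk₁ : k < 1) (hk : Real.exp k = R * k) (hQc : Continuous Q) (hQ₀ : ∀ t, 0 ≤ Q t)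
    (hQ : ∀ t < 0, ∀ h > 0, Q t + h * (Q (t + 1) / R) ≤ Q (t + h)) :
    k * ∫ t in (0 : ℝ)..1, Real.exp (-k * t) * Q t ≤ Q 0 := by
  set P : ℝ → ℝ := fun t => Real.exp (-k * t) * Q t with hP
  have hPc : Continuous P := by fun_prop
  have hP₀ : ∀ t, 0 ≤ P t := fun t => mul_nonneg (Real.exp_pos _).le (hQ₀ t)
  have hPi : ∀ a b, IntervalIntegrable P volume a b := fun a b => hPc.intervalIntegrable a b
  have hI : ∀ s, HasDerivAt (fun s => ∫ t in s..(s + 1), P t) (P (s + 1) - P s) s := by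
    intro s
    have h1 : ∀ x, HasDerivAt (fun x => ∫ t in (0 : ℝ)..x, P t) (P x) x := fun x =>
      intervalIntegral.integral_hasDerivAt_right (hPi 0 x)
        hPc.stronglyMeasurable.stronglyMeasurableAtFilter hPc.continuousAt
    have h2 := ((h1 (s + 1)).comp_add_const s 1).sub (h1 s)
    refine h2.congr_of_eventuallyEq (Eventually.of_forall fun x => ?_)
    exact (intervalIntegral.integral_interval_sub_left (hPi 0 _) (hPi 0 _)).symm
  -- Since `exp k = R * k`, formally `f' s = exp (-k * s) * (Q (s + 1) / R - Q' s) ≤ 0` for `s < 0`.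
  set f : ℝ → ℝ := fun s => k * (∫ t in s..(s + 1), P t) - P s with hf
  have hfc : Continuous f :=
    ((continuous_iff_continuousAt.2 fun s => (hI s).continuousAt).const_mul k).sub hPc
  have hanti : ∀ s ≤ 0, f 0 ≤ f s := by
    intro s hs
    refine image_le_of_liminf_slope_right_le_deriv_boundary (f := f) (B := fun _ => f s)
      (B' := fun _ => 0) (a := s) (b := 0) hfc.continuousOn le_rfl continuousOn_const
      (fun x _ => (hasDerivAt_const x _).hasDerivWithinAt) ?_ (Set.right_mem_Icc.2 hs)
    intro x hx r hr
    -- `Q` need not be differentiable: replacing it by its affine minorant to the right of `x` gives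
    -- a differentiable `g ≥ f` there, with `g x = f x`.
    set g : ℝ → ℝ := fun z => k * (∫ t in z..(z + 1), P t)
      - Real.exp (-k * z) * (Q x + (z - x) * (Q (x + 1) / R)) with hg
    have hgd : HasDerivAt g 0 x := by
      have e1 : HasDerivAt (fun z : ℝ => Real.exp (-k * z)) (Real.exp (-k * x) * (-k)) x := by
        simpa using ((hasDerivAt_id x).const_mul (-k)).exp
      have e2 : HasDerivAt (fun z : ℝ => Q x + (z - x) * (Q (x + 1) / R)) (Q (x + 1) / R) x := by
        simpa using (((hasDerivAt_id x).sub_const x).mul_const (Q (x + 1) / R)).const_add (Q x)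
      have e3 := ((hI x).const_mul k).sub (e1.mul e2)
      refine e3.congr_deriv ?_
      have e4 : Real.exp (-k * (x + 1)) = Real.exp (-k * x) / (R * k) := by
        rw [← hk, ← Real.exp_sub]; congr 1; ring
      simp only [hP, e4]
      field_simp
      ring
    have hslope := (hasDerivAt_iff_tendsto_slope.1 hgd).mono_left
      (nhdsWithin_mono x (fun z hz => ne_of_gt hz : Set.Ioi x ⊆ {x}ᶜ))
    refine Eventually.frequently ?_
    filter_upwards [hslope.eventually_lt_const hr, self_mem_nhdsWithin] with z hz hxz
    refine lt_of_le_of_lt ?_ hz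
    have hxz : x < z := hxz
    simp only [slope_def_field]
    refine div_le_div_of_nonneg_right ?_ (sub_pos.2 hxz).le
    have h3 := hQ x hx.2 (z - x) (sub_pos.2 hxz)
    rw [add_sub_cancel] at h3
    have h4 := mul_le_mul_of_nonneg_left h3 (Real.exp_pos (-k * z)).le
    simp only [hf, hg, hP, sub_self, zero_mul, add_zero]
    linarith
  by_contra hcon
  have hd : 0 < f 0 := by
    have : P 0 = Q 0 := by simp [hP]
    simp only [hf, this, zero_add]
    linarith [not_le.1 hcon]
  set d := f 0 with hd_def
  have key : ∀ s ≤ 0, ∀ c, (∀ t ∈ Set.Icc s (s + 1), P t ≤ c) → P s + d ≤ k * c := by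
    intro s hs c hc
    have h1 : ∫ t in s..(s + 1), P t ≤ ∫ _ in s..(s + 1), c :=
      intervalIntegral.integral_mono_on (by linarith) (hPi _ _) (by simp) hc
    have h2 := hanti s hs
    have h3 := mul_le_mul_of_nonneg_left h1 hk₀.le
    simp only [intervalIntegral.integral_const, add_sub_cancel_left, one_smul] at h3
    simp only [hf] at h2
    linarith
  obtain ⟨m, -, hm⟩ := isCompact_Icc.exists_isMaxOn (Set.nonempty_Icc.2 (zero_le_one' ℝ))
    hPc.continuousOn
  -- As `k < 1`, `key` forbids a maximum of `P` over `[s, 1]` at a point `y ≤ 0`.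
  have hbound : ∀ s ≤ 1, P s ≤ P m := by
    intro s hs
    obtain ⟨y, hy, hy'⟩ := isCompact_Icc.exists_isMaxOn (Set.nonempty_Icc.2 hs) hPc.continuousOn
    have hsy : P s ≤ P y := hy' (Set.left_mem_Icc.2 hs)
    rcases le_or_gt y 0 with h0 | h0
    · have := key y h0 (P y) fun t ht => hy' ⟨hy.1.trans ht.1, by linarith [ht.2]⟩
      nlinarith [hP₀ y]
    · exact hsy.trans (hm ⟨h0.le, hy.2⟩)
  -- Each unit step to the left costs another `d`, which eventually contradicts `P ≥ 0`.
  have hdecay : ∀ n : ℕ, ∀ s ≤ 1 - (n : ℝ), P s ≤ P m - n * d := by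
    intro n
    induction n with
    | zero => simpa using hbound
    | succ n ih =>
      intro s hs
      push_cast at hs ⊢
      have h0 : (0 : ℝ) ≤ n := n.cast_nonneg
      have h1 := key s (by linarith) (P m - n * d) fun t ht => ih t (by linarith [ht.2])
      have h2 := (hP₀ s).trans (ih s (by linarith))
      nlinarith
  obtain ⟨n, hn⟩ := exists_nat_gt (P m / d)
  have h1 := (hP₀ _).trans (hdecay n _ le_rfl)
  rw [div_lt_iff₀ hd] at hn
  linarith

/-! ### Passing to the conjugate of the profile. -/

/-- If `a` is the profile of expected truncated bids below `U` and `M` bounds its slope from below,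
then the robustness inequality `a v + v ≤ R * u + v * M u` forces `a U` to be large. -/
theorem le_profile_of_robust {a M : ℝ → ℝ} {U R k : ℝ} (hU : 0 < U) (hR : 0 < R) (hk₀ : 0 < k)
    (hk₁ : k < 1) (hk : Real.exp k = R * k)
    (ha : ∀ v, 0 < v → v ≤ U → 0 ≤ a v)
    (hslope : ∀ v v', 0 < v → v ≤ v' → v' ≤ U → a v + (v' - v) * M v' ≤ a v')
    (hrob : ∀ u v, 0 < u → u ≤ U → 0 < v → v ≤ U → a v + v ≤ R * u + v * M u)
    (hMU : M U = 0) :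
    U * (R - 1 / k - 1) ≤ a U := by
  have haU : ∀ v, 0 < v → v ≤ U → a v ≤ a U := fun v h0 h1 => by
    have := hslope v U h0 h1 le_rfl
    rwa [hMU, mul_zero, add_zero] at this
  have : Nonempty (Set.Ioc 0 U) := ⟨⟨U, hU, le_rfl⟩⟩
  set Q : ℝ → ℝ := fun t => ⨆ v : Set.Ioc 0 U, (a v + v * t) with hQ
  have hbdd : ∀ t, BddAbove (Set.range fun v : Set.Ioc 0 U => a v + v * t) := by
    intro t
    refine ⟨a U + U * |t|, ?_⟩
    rintro _ ⟨⟨v, hv0, hv1⟩, rfl⟩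
    have h1 : v * t ≤ U * |t| :=
      (mul_le_mul_of_nonneg_left (le_abs_self t) hv0.le).trans
        (mul_le_mul_of_nonneg_right hv1 (abs_nonneg t))
    exact add_le_add (haU v hv0 hv1) h1
  have hle : ∀ t v, 0 < v → v ≤ U → a v + v * t ≤ Q t := fun t v h0 h1 =>
    le_ciSup (hbdd t) ⟨v, h0, h1⟩
  have hge : ∀ t c, (∀ v, 0 < v → v ≤ U → a v + v * t ≤ c) → Q t ≤ c := fun t c h =>
    ciSup_le fun v => h v v.2.1 v.2.2
  have hmono : Monotone Q := fun s t hst => hge s _ fun v h0 h1 =>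
    (by gcongr : a v + v * s ≤ a v + v * t).trans (hle t v h0 h1)
  have hlip : ∀ s t, s ≤ t → Q t ≤ Q s + U * (t - s) := fun s t hst => hge t _ fun v h0 h1 => by
    have h2 := hle s v h0 h1
    have h3 := mul_le_mul_of_nonneg_right h1 (sub_nonneg.2 hst)
    linarith
  have hQc : Continuous Q := by
    refine (LipschitzWith.of_le_add_mul ⟨U, hU.le⟩ fun t s => ?_).continuous
    change Q t ≤ Q s + U * dist t s
    rcases le_total s t with h | h
    · rw [Real.dist_eq, abs_of_nonneg (sub_nonneg.2 h)]
      exact hlip s t h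
    · exact (hmono h).trans (le_add_of_nonneg_right (by positivity))
  have hQ₀ : ∀ t, 0 ≤ Q t := by
    intro t
    refine le_of_forall_pos_sub_le fun δ hδ => ?_
    set v := min U (δ / (|t| + 1)) with hv
    have h0 : 0 < v := lt_min hU (by positivity)
    have h1 : v * |t| ≤ δ := by
      have h2 : v ≤ δ / (|t| + 1) := min_le_right _ _
      rw [le_div_iff₀ (by positivity)] at h2
      nlinarith [abs_nonneg t]
    have h3 := hle t v h0 (min_le_left _ _)
    have h4 := ha v h0 (min_le_left _ _)
    have h5 : -(v * |t|) ≤ v * t := by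
      have := mul_le_mul_of_nonneg_left (neg_abs_le t) h0.le
      linarith
    linarith
  have hQR : ∀ u t, 0 < u → u ≤ U → t ≤ -M u → Q (t + 1) ≤ R * u := fun u t h0 h1 ht =>
    hge _ _ fun v hv0 hv1 => by
      have h2 := hrob u v h0 h1 hv0 hv1
      have h3 := mul_le_mul_of_nonneg_left ht hv0.le
      linarith
  -- By `hQR`, every `y < q` has slope `M y > -t`, so moving `v` up towards `q` does not lower `a v
  -- + v * t`. Near-maximizers may thus be taken close to or above `q`, where `Q` grows at rate at
  -- least `q`.
  have hgrow : ∀ t < 0, ∀ h > 0, Q t + h * (Q (t + 1) / R) ≤ Q (t + h) := by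
    intro t ht h hh
    set q := Q (t + 1) / R with hq
    have hq₀ : 0 ≤ q := div_nonneg (hQ₀ _) hR.le
    have hqu : ∀ u, 0 < u → u < q → u ≤ U → t ≤ -M u → False := fun u h0 h1 h2 h3 => by
      have := hQR u t h0 h2 h3
      rw [hq, lt_div_iff₀ hR] at h1
      linarith
    have hqU : q ≤ U := by
      by_contra hc
      exact hqu U hU (not_le.1 hc) le_rfl (by rw [hMU]; linarith)
    suffices H : ∀ v, 0 < v → v ≤ U → a v + v * t ≤ Q (t + h) - h * q by
      linarith [hge t _ H]
    intro v hv0 hv1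
    rcases le_or_gt q v with hvq | hvq
    · have h1 := hle (t + h) v hv0 hv1
      have h2 := mul_le_mul_of_nonneg_right hvq hh.le
      linarith
    · have hstep : ∀ y, v < y → y < q → a v + v * t + h * y ≤ Q (t + h) := by
        intro y hvy hyq
        have hy0 : 0 < y := hv0.trans hvy
        have hyU : y ≤ U := hyq.le.trans hqU
        have h1 : -M y < t := by
          by_contra hc
          exact hqu y hy0 hyq hyU (not_lt.1 hc)
        have h2 := hslope v y hv0 hvy.le hyU
        have h3 := hle (t + h) y hy0 hyU
        have h4 := mul_nonneg (sub_pos.2 hvy).le (by linarith : 0 ≤ t + M y)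
        linarith
      have hlim : h * q ≤ Q (t + h) - (a v + v * t) := by
        have h1 : q ≤ (Q (t + h) - (a v + v * t)) / h := by
          refine le_of_forall_lt_imp_le_of_dense fun y hy => ?_
          rcases le_or_gt y v with hyv | hyv
          · obtain ⟨y', h2, h3⟩ := exists_between hvq
            rw [le_div_iff₀ hh]
            have := hstep y' h2 h3
            nlinarith
          · rw [le_div_iff₀ hh]
            linarith [hstep y hyv hy]
        rw [le_div_iff₀ hh] at h1
        linarith
      linarith
  have hQ0 : Q 0 = a U := le_antisymm
    (hge 0 _ fun v h0 h1 => by simpa using haU v h0 h1) (by simpa using hle 0 U hU le_rfl)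
  have hmain := boundary_le_of_advanced_growth hR hk₀ hk₁ hk hQc hQ₀ hgrow
  rw [hQ0, ← intervalIntegral.integral_const_mul] at hmain
  have hF : ∀ t : ℝ, HasDerivAt (fun t => -(Real.exp (-k * t) * (a U + U * t + U / k)))
      (k * (Real.exp (-k * t) * (a U + U * t))) t := by
    intro t
    have e1 : HasDerivAt (fun z : ℝ => Real.exp (-k * z)) (Real.exp (-k * t) * (-k)) t := by
      simpa using ((hasDerivAt_id t).const_mul (-k)).exp
    have e2 : HasDerivAt (fun z : ℝ => a U + U * z + U / k) U t := by
      simpa using (((hasDerivAt_id t).const_mul U).const_add (a U)).add_const (U / k)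
    refine (e1.mul e2).neg.congr_deriv ?_
    field_simp
    ring
  have hFc : Continuous fun t : ℝ => k * (Real.exp (-k * t) * (a U + U * t)) := by fun_prop
  have hint := intervalIntegral.integral_eq_sub_of_hasDerivAt (a := 0) (b := 1)
    (fun t _ => hF t) (hFc.intervalIntegrable _ _)
  -- Only the line `v = U` of the supremum is kept; it is exact at `t = 0`.
  have hcmp : ∫ t in (0 : ℝ)..1, k * (Real.exp (-k * t) * (a U + U * t))
      ≤ ∫ t in (0 : ℝ)..1, k * (Real.exp (-k * t) * Q t) := by
    refine intervalIntegral.integral_mono_on zero_le_one (hFc.intervalIntegrable _ _)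
      ((by fun_prop : Continuous fun t : ℝ => k * (Real.exp (-k * t) * Q t)).intervalIntegrable _ _)
      fun t _ => ?_
    gcongr
    exact hle t U hU le_rfl
  rw [hint] at hcmp
  have h1 := hcmp.trans hmain
  have hexp : Real.exp (-k * 1) = 1 / (R * k) := by
    rw [← hk, mul_one, Real.exp_neg, one_div]
  rw [hexp] at h1
  simp only [mul_zero, Real.exp_zero, add_zero, mul_one, one_mul] at h1
  have hRk : 0 < R * k := by positivity
  have h2 : U / k ≤ 1 / (R * k) * (a U + U + U / k) := by linarith
  rw [one_div_mul_eq_div, le_div_iff₀ hRk] at h2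
  have h3 : U / k * (R * k) = U * R := by field_simp
  have h4 : U * (1 / k) = U / k := by ring
  linarith

/-! ### Pathwise inequalities for bids. -/

open Classical in
/-- The sum of the bids below `U`, truncated at `v`. -/
noncomputable def truncatedBids (U v : ℝ) (x : ℤ → ℝ) : ℝ≥0∞ :=
  ∑' j : ℤ, if x j < U then ENNReal.ofReal (min (x j) v) else 0

open Classical in
/-- The number of bids in `[u, U)`. -/
noncomputable def bidCount (U u : ℝ) (x : ℤ → ℝ) : ℝ≥0∞ :=
  ∑' j : ℤ, if u ≤ x j ∧ x j < U then 1 else 0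

theorem measurable_truncatedBids (U v : ℝ) : Measurable (truncatedBids U v) := by
  refine Measurable.tsum fun j => Measurable.ite ?_ (by fun_prop) measurable_const
  exact measurableSet_lt (measurable_pi_apply j) measurable_const

theorem measurable_bidCount (U u : ℝ) : Measurable (bidCount U u) := by
  refine Measurable.tsum fun j => Measurable.ite ?_ measurable_const measurable_const
  exact (measurableSet_le measurable_const (measurable_pi_apply j)).inter
    (measurableSet_lt (measurable_pi_apply j) measurable_const)

theorem measurable_bidCost (u : ℝ) : Measurable fun x : ℤ → ℝ => bidCost x u := by
  refine Measurable.tsum fun j => Measurable.ite ?_ (by fun_prop) measurable_const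
  exact measurableSet_lt (measurable_pi_apply (j - 1)) measurable_const

theorem bidCount_self (U : ℝ) (x : ℤ → ℝ) : bidCount U U x = 0 := by
  refine ENNReal.tsum_eq_zero.2 fun j => if_neg fun h => ?_
  exact absurd h.2 (not_lt.2 h.1)

/-- Termwise: the extra `v` is charged to the first bid `x i ≥ u`. If `x i < U`, the count pays for
its truncation and the cost for `v`; otherwise `x i ≥ U ≥ v` pays alone. -/
theorem truncatedBids_add_le {x : ℤ → ℝ} (hx : IsBiddingSequence x) {U u v : ℝ} (hu : 0 < u)
    (huU : u ≤ U) (hvU : v ≤ U) :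
    truncatedBids U v x + ENNReal.ofReal v ≤ bidCost x u + ENNReal.ofReal v * bidCount U u x := by
  classical
  obtain ⟨i, hi₁, hi₂⟩ := hx.reaches u hu
  have h1 : ENNReal.ofReal v ≤
      ∑' j : ℤ, if x (j - 1) < u ∧ u ≤ x j then ENNReal.ofReal v else 0 := by
    refine le_trans ?_ (ENNReal.le_tsum i)
    rw [if_pos ⟨hi₁, hi₂⟩]
  refine (add_le_add_right h1 _).trans ?_
  rw [truncatedBids, bidCost, bidCount, ← ENNReal.tsum_mul_left, ← ENNReal.tsum_add,
    ← ENNReal.tsum_add]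
  refine ENNReal.tsum_le_tsum fun j => ?_
  have hj : x (j - 1) ≤ x j := hx.mono (by omega)
  rcases lt_or_ge (x j) u with h2 | h2
  · simp [h2.trans_le huU, hj.trans_lt h2, not_le.2 h2]
  · rcases lt_or_ge (x (j - 1)) u with h3 | h3 <;> rcases lt_or_ge (x j) U with h4 | h4
    · simp [h2, h3, h4]
    · simpa [h2, h3, not_lt.2 h4] using ENNReal.ofReal_le_ofReal (hvU.trans h4)
    · simp [h2, not_lt.2 h3, h4]
    · simp [not_lt.2 h3, not_lt.2 h4]

/-- Raising the truncation level adds exactly `v' - v` to each bid in `[v', U)` and lowers no term.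
-/
theorem truncatedBids_add_mul_le {U v v' : ℝ} (x : ℤ → ℝ) (hv : 0 ≤ v) (hvv' : v ≤ v') :
    truncatedBids U v x + ENNReal.ofReal (v' - v) * bidCount U v' x ≤ truncatedBids U v' x := by
  classical
  rw [truncatedBids, bidCount, ← ENNReal.tsum_mul_left, ← ENNReal.tsum_add]
  refine ENNReal.tsum_le_tsum fun j => ?_
  by_cases h1 : x j < U
  · by_cases h2 : v' ≤ x j
    · simp only [h1, h2, and_self, if_true, mul_one, min_eq_right h2, min_eq_right (hvv'.trans h2)]
      rw [← ENNReal.ofReal_add hv (sub_nonneg.2 hvv'), add_sub_cancel]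
    · simpa [h1, h2] using ENNReal.ofReal_le_ofReal (min_le_min_left (x j) hvv')
  · simp [h1]

/-! ### Expectations and the final bound. -/

theorem lintegral_bidCost_ge {R w : ℝ} (hw₁ : 1 < w) (hw : w * Real.exp (1 / w) = R)
    {Ω : Type*} [MeasurableSpace Ω] (μ : Measure Ω) [IsProbabilityMeasure μ]
    (X : ℤ → Ω → ℝ) (hX : IsRandomizedBiddingSequence μ X)
    (hrob : ∀ u, 0 < u → ∫⁻ ω, bidCost (fun i => X i ω) u ∂μ ≤ ENNReal.ofReal (R * u))
    {U : ℝ} (hU : 0 < U) :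
    ENNReal.ofReal (U * (R - w)) ≤ ∫⁻ ω, bidCost (fun i => X i ω) U ∂μ := by
  have hw₀ : 0 < w := zero_lt_one.trans hw₁
  have hR : 0 < R := hw ▸ mul_pos hw₀ (Real.exp_pos _)
  have hXm : Measurable fun ω => fun i => X i ω := measurable_pi_lambda _ hX.measurable
  set A : ℝ → ℝ≥0∞ := fun v => ∫⁻ ω, truncatedBids U v (fun i => X i ω) ∂μ with hA
  set N : ℝ → ℝ≥0∞ := fun u => ∫⁻ ω, bidCount U u (fun i => X i ω) ∂μ with hN
  set C : ℝ → ℝ≥0∞ := fun u => ∫⁻ ω, bidCost (fun i => X i ω) u ∂μ with hC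
  have hAm : ∀ v, Measurable fun ω => truncatedBids U v (fun i => X i ω) := fun v =>
    (measurable_truncatedBids U v).comp hXm
  have hNm : ∀ v, Measurable fun ω => bidCount U v (fun i => X i ω) := fun v =>
    (measurable_bidCount U v).comp hXm
  have hCm : ∀ v, Measurable fun ω => bidCost (fun i => X i ω) v := fun v =>
    (measurable_bidCost v).comp hXm
  have hNU : N U = 0 := by simp [hN, bidCount_self]
  have hineq : ∀ u v, 0 < u → u ≤ U → v ≤ U →
      A v + ENNReal.ofReal v ≤ C u + ENNReal.ofReal v * N u := by
    intro u v h0 h1 h2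
    have h3 : ∫⁻ ω, (truncatedBids U v (fun i => X i ω) + ENNReal.ofReal v) ∂μ ≤
        ∫⁻ ω, (bidCost (fun i => X i ω) u
          + ENNReal.ofReal v * bidCount U u (fun i => X i ω)) ∂μ :=
      lintegral_mono_ae (hX.ae_bidding.mono fun ω hω => truncatedBids_add_le hω h0 h1 h2)
    rwa [lintegral_add_left (hAm v), lintegral_add_left (hCm u),
      lintegral_const_mul _ (hNm u), lintegral_const, measure_univ, mul_one] at h3
  have hslope : ∀ v v', 0 ≤ v → v ≤ v' → A v + ENNReal.ofReal (v' - v) * N v' ≤ A v' := by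
    intro v v' h0 h1
    have h3 : ∫⁻ ω, (truncatedBids U v (fun i => X i ω)
        + ENNReal.ofReal (v' - v) * bidCount U v' (fun i => X i ω)) ∂μ ≤
        ∫⁻ ω, truncatedBids U v' (fun i => X i ω) ∂μ :=
      lintegral_mono fun ω => truncatedBids_add_mul_le _ h0 h1
    rwa [lintegral_add_left (hAm v), lintegral_const_mul _ (hNm v')] at h3
  have hCtop : ∀ u, 0 < u → C u ≠ ⊤ := fun u h => ((hrob u h).trans_lt ENNReal.ofReal_lt_top).ne
  have hAC : ∀ v, v ≤ U → A v + ENNReal.ofReal v ≤ C U := fun v h => by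
    simpa [hNU] using hineq U v hU le_rfl h
  have hAtop : ∀ v, v ≤ U → A v ≠ ⊤ := fun v h =>
    ((le_self_add.trans (hAC v h)).trans_lt (hCtop U hU).lt_top).ne
  have hNtop : ∀ v, 0 < v → v ≤ U → N v ≠ ⊤ := by
    intro v h0 h1 h2
    have h3 := le_add_self.trans (hslope 0 v le_rfl h0.le)
    -- Markov's inequality: the slope bound from level `0` gives `v * N v ≤ A v`.
    rw [h2, sub_zero, ENNReal.mul_top (by simpa using h0), top_le_iff] at h3
    exact hAtop v h1 h3
  -- The exponent is `k = 1 / w`; `w > 1` makes it the root below `1` of `exp k = R * k`.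
  have hmain : U * (R - 1 / (1 / w) - 1) ≤ (A U).toReal := by
    refine le_profile_of_robust (a := fun v => (A v).toReal) (M := fun v => (N v).toReal) hU hR
      (one_div_pos.2 hw₀) ((div_lt_one hw₀).2 hw₁) ?_ (fun v _ _ => ENNReal.toReal_nonneg) ?_ ?_ ?_
    · rw [← hw]
      field_simp
    · intro v v' h0 h1 h2
      have h3 := ENNReal.toReal_mono (hAtop v' h2) (hslope v v' h0.le h1)
      rwa [ENNReal.toReal_add (hAtop v (h1.trans h2))
        (ENNReal.mul_ne_top ENNReal.ofReal_ne_top (hNtop v' (h0.trans_le h1) h2)),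
        ENNReal.toReal_mul, ENNReal.toReal_ofReal (sub_nonneg.2 h1)] at h3
    · intro u v h0 h1 h2 h3
      have h4 : ENNReal.ofReal v * N u ≠ ⊤ :=
        ENNReal.mul_ne_top ENNReal.ofReal_ne_top (hNtop u h0 h1)
      have h5 := ENNReal.toReal_mono (ENNReal.add_ne_top.2 ⟨hCtop u h0, h4⟩) (hineq u v h0 h1 h3)
      rw [ENNReal.toReal_add (hAtop v h3) ENNReal.ofReal_ne_top,
        ENNReal.toReal_add (hCtop u h0) h4, ENNReal.toReal_mul, ENNReal.toReal_ofReal h2.le] at h5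
      have h6 := ENNReal.toReal_mono ENNReal.ofReal_ne_top (hrob u h0)
      rw [ENNReal.toReal_ofReal (by positivity)] at h6
      exact h5.trans (add_le_add_left h6 _)
    · simp [hNU]
  rw [one_div_one_div] at hmain
  refine le_trans ?_ (hAC U le_rfl)
  rw [← ENNReal.ofReal_toReal (hAtop U le_rfl), ← ENNReal.ofReal_add ENNReal.toReal_nonneg hU.le]
  exact ENNReal.ofReal_le_ofReal (by linarith)

theorem theorem5p3 (R : ℝ) (hR : Real.exp 1 < R) (w : ℝ) (hw₁ : 1 < w)
    (hw : IsGreatest {v : ℝ | 0 < v ∧ v * Real.exp (1 / v) = R} w)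
    (ε : ℝ) (hε : 0 < ε)
    {Ω : Type*} [MeasurableSpace Ω] (μ : Measure Ω) [IsProbabilityMeasure μ]
    (X : ℤ → Ω → ℝ) (hX : IsRandomizedBiddingSequence μ X)
    (hrob : robustness μ X ≤ ENNReal.ofReal R) :
    ENNReal.ofReal (R - w - ε) ≤ consistency μ X ∧
      ∀ û : ℝ, 0 < û → ENNReal.ofReal (R - w - ε) ≤ consistencyAt μ X û := by
  have hR₀ : 0 < R := (Real.exp_pos 1).trans hR
  have hcost : ∀ u, 0 < u → ∫⁻ ω, bidCost (fun i => X i ω) u ∂μ ≤ ENNReal.ofReal (R * u) := by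
    intro u hu
    have h1 : normalizedCost μ X u ≤ ENNReal.ofReal R :=
      (le_iSup₂ (f := fun (u : ℝ) (_ : 0 < u) => normalizedCost μ X u) u hu).trans hrob
    rw [normalizedCost, ENNReal.div_le_iff (by simpa using hu) ENNReal.ofReal_ne_top] at h1
    rwa [ENNReal.ofReal_mul hR₀.le]
  have hmain : ∀ u : ℝ, 0 < u → ENNReal.ofReal (R - w - ε) ≤ normalizedCost μ X u := by
    intro u hu
    rw [normalizedCost, ENNReal.le_div_iff_mul_le (Or.inl (by simpa using hu))
      (Or.inl ENNReal.ofReal_ne_top), mul_comm, ← ENNReal.ofReal_mul hu.le]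
    exact (ENNReal.ofReal_le_ofReal (mul_le_mul_of_nonneg_left (by linarith) hu.le)).trans
      (lintegral_bidCost_ge hw₁ hw.1.2 μ X hX hcost hu)
  exact ⟨le_iInf₂ hmain, hmain⟩
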